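/- Let $\kappa\in\{2,3,4,\dots\}\cup\{\infty\}$ and let $P_\kappa$ be the free monoid of all finite words (including the empty word) in $\kappa$ letters, where $\kappa=\infty$ means countably infinitely many letters. Let $\ell_2(P_\kappa)$ be the complex Hilbert space with orthonormal basis $\{e_x : x\in P_\kappa\}$ (the full Fock space). Each finite linear combination $p=\sum_x a_x e_x$, $a_x\in\mathbb C$, acts on $\ell_2(P_\kappa)$ as the bounded operator of left multiplication, $e_y\mapsto \sum_x a_x e_{xy}$; let $\mathbb F^\infty(\kappa)\subset B(\ell_2(P_\kappa))$ be the closure of the set of these operators in the strong operator topology. For a linear space $X$ of bounded operators on a Hilbert space $H$, norm the space $M_n(X)$ of $n\times n$ matrices over $X$ as a subspace of $B(H\oplus\cdots\oplus H)$ ($n$ copies, Hilbert space direct sum). A linear map $u:X\to Y$ between such spaces is completely bounded if $\sup_{n\ge 1}\|u_n\|<\infty$, where $u_n:M_n(X)\to M_n(Y)$, $u_n[(x_{ij})]=[(u(x_{ij}))]$; and $X$, $Y$ are completely isomorphic if there is a linear bijection $u:X\to Y$ such that $u$ and $u^{-1}$ are both completely bounded. Theorem. For every integer $k\ge 2$,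 $\mathbb F^\infty(k)$ is completely isomorphic to $\mathbb F^\infty(\infty)$. -/

import Mathlib

noncomputable section

/-- The full Fock space on the letters `ι`: the Hilbert space `ℓ²` over the words in `ι`. -/
abbrev FockSpace (ι : Type*) : Type _ := lp (fun _ : FreeMonoid ι => ℂ) 2

/-- The standard orthonormal basis vector `e_x` attached to a word `x`. -/
def fockBasis {ι : Type*} (x : FreeMonoid ι) : FockSpace ι := by
  classical exact lp.single 2 x (1 : ℂ)

theorem orthonormal_fockBasis (ι : Type*) :
    Orthonormal ℂ (fockBasis : FreeMonoid ι → FockSpace ι) := by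
  classical
  rw [orthonormal_iff_ite]
  intro x y
  simp only [fockBasis, lp.inner_single_left, lp.single_apply, Pi.single_apply]
  split_ifs <;> simp

theorem orthonormal_fockBasis_mul {ι : Type*} (x : FreeMonoid ι) :
    Orthonormal ℂ (fun y : FreeMonoid ι => fockBasis (x * y)) :=
  (orthonormal_fockBasis ι).comp (fun y => x * y) (mul_right_injective x)

/-- Left multiplication by the basis vector `e_x`: the isometry of the Fock space determined by
`e_y ↦ e_{xy}`. For `x` a single letter this is a left creation operator. -/
def leftMul {ι : Type*} (x : FreeMonoid ι) : FockSpace ι →L[ℂ] FockSpace ι :=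
  (orthonormal_fockBasis_mul x).orthogonalFamily.linearIsometry.toContinuousLinearMap

theorem leftMul_fockBasis {ι : Type*} (x y : FreeMonoid ι) :
    leftMul x (fockBasis y) = fockBasis (x * y) := by
  classical
  simp [leftMul, fockBasis]

/-- The operators on the Fock space of left multiplication by a noncommutative polynomial, i.e. by
a finite linear combination of the basis vectors `e_x`. -/
def polynomialOperators (ι : Type*) : Submodule ℂ (FockSpace ι →L[ℂ] FockSpace ι) :=
  Submodule.span ℂ (Set.range leftMul)

section OperatorSpaces

variable {H : Type*} [NormedAddCommGroup H] [InnerProductSpace ℂ H]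
variable {K : Type*} [NormedAddCommGroup K] [InnerProductSpace ℂ K]

/-- The closure of a space of bounded operators in the strong operator topology, which is the
topology of pointwise convergence in norm. -/
def sotClosure (S : Submodule ℂ (H →L[ℂ] H)) : Submodule ℂ (H →L[ℂ] H) :=
  let toSOT : (H →L[ℂ] H) →ₗ[ℂ] (H →Lₚₜ[ℂ] H) :=
    (ContinuousLinearMap.toPointwiseConvergenceCLM ℂ (RingHom.id ℂ) H H).toLinearMap
  (S.map toSOT).topologicalClosure.comap toSOT

/-- The operator on `H ⊕ ⋯ ⊕ H` (`n` copies, Hilbert space direct sum) given by an `n × n` matrix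
of operators on `H`. -/
def matrixOperator {n : ℕ} (A : Matrix (Fin n) (Fin n) (H →L[ℂ] H)) :
    PiLp 2 (fun _ : Fin n => H) →L[ℂ] PiLp 2 (fun _ : Fin n => H) :=
  (PiLp.continuousLinearEquiv 2 ℂ (fun _ : Fin n => H)).symm.toContinuousLinearMap ∘L
    (ContinuousLinearMap.pi fun i => ∑ j, A i j ∘L ContinuousLinearMap.proj j) ∘L
    (PiLp.continuousLinearEquiv 2 ℂ (fun _ : Fin n => H)).toContinuousLinearMap

theorem matrixOperator_apply {n : ℕ} (A : Matrix (Fin n) (Fin n) (H →L[ℂ] H))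
    (v : PiLp 2 (fun _ : Fin n => H)) (i : Fin n) :
    matrixOperator A v i = ∑ j, A i j (v j) := by
  simp [matrixOperator]

/-- The norm of `M_n(X)`, for a space `X` of bounded operators on `H`: the operator norm on
`H ⊕ ⋯ ⊕ H`. -/
def matrixNorm {X : Submodule ℂ (H →L[ℂ] H)} {n : ℕ} (A : Matrix (Fin n) (Fin n) X) : ℝ :=
  ‖matrixOperator (A.map fun x => (x : H →L[ℂ] H))‖

/-- A linear map between spaces of operators is completely bounded if its entrywise
amplifications `M_n(X) → M_n(Y)` are bounded uniformly in `n`. -/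
def IsCompletelyBounded {X : Submodule ℂ (H →L[ℂ] H)} {Y : Submodule ℂ (K →L[ℂ] K)}
    (u : X →ₗ[ℂ] Y) : Prop :=
  ∃ C : ℝ, ∀ (n : ℕ) (A : Matrix (Fin n) (Fin n) X), matrixNorm (A.map u) ≤ C * matrixNorm A

/-- Two spaces of operators are completely isomorphic if there is a linear bijection between them
which is completely bounded together with its inverse. -/
def CompletelyIsomorphic (X : Submodule ℂ (H →L[ℂ] H)) (Y : Submodule ℂ (K →L[ℂ] K)) : Prop :=
  ∃ u : X ≃ₗ[ℂ] Y, IsCompletelyBounded u.toLinearMap ∧ IsCompletelyBounded u.symm.toLinearMap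

end OperatorSpaces

/-- The noncommutative analytic Toeplitz algebra on the letters `ι`: the closure in the strong
operator topology of the polynomials, acting by left multiplication on the Fock space. -/
def analyticToeplitz (ι : Type*) : Submodule ℂ (FockSpace ι →L[ℂ] FockSpace ι) :=
  sotClosure (polynomialOperators ι)

end

/-! An operator in the algebra is left convolution by its symbol, the image of the vacuum vector, so
the algebra is a space of coefficient functions on words. The isomorphism is a bijection between the
two sets of words. It comes from Pełczyński's decomposition method, in which every isomorphism
permutes coordinates.

Three splittings feed the method. Let X and Y be the spaces for countably many and for k letters. A
bifix code generates a free submonoid, and restricting symbols to it is a completely contractive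
projection: `BifixCode.bound_comp` compresses to the span of the submonoid, and
`BifixCode.bound_extend` amplifies back. The code of single letters embeds Y in X. The code b a^i b
embeds X in Y, which is where k ≥ 2 enters. Finally, a symbol without constant term is a sum of
creation operators times operators of the algebra. The ranges are orthogonal, so X is the scalars
plus the infinite columns over X (`fock_nat_iso_sum_col`). Then `CoordSpace.Iso.of_decomposition`
applies.

To return to operators, the symbols of the strongly closed algebra must be exactly the bounded ones
(`mem_range_symbolMap`). Contractive Cesàro means (`FockBound.cesaro`) approximate any bounded
symbol by polynomials. -/

open scoped ENNReal NNReal Topology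
open Filter

noncomputable section

/-! ### Coordinate operator spaces and the decomposition method. -/

/-- An index set together with a family of quadratic forms on the `n`-tuples of coefficient
functions on it. Finiteness of the supremum of the forms over the test vectors of weight at most
one singles out an operator space that is coordinatized by the index set. -/
structure CoordSpace where
  index : Type
  Test : ℕ → Type
  weight : ∀ {n : ℕ}, Test n → ℝ≥0∞
  form : ∀ {n : ℕ}, Test n → (index → Fin n → ℂ) → ℝ≥0∞

namespace CoordSpace

/-- The `ι × n` matrix `f` of coefficient functions has squared norm at most `D`. -/
def Bound (A : CoordSpace) {ι : Type} {n : ℕ} (f : ι → A.index → Fin n → ℂ) (D : ℝ≥0) : Prop :=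
  -- Infinite weight has to be excluded because of `D = 0`, where the right side would be `0 * ⊤ =
  -- 0`.
  ∀ g : A.Test n, A.weight g ≠ ⊤ → ∑' p, A.form g (f p) ≤ D * A.weight g

theorem Bound.mono {A : CoordSpace} {ι : Type} {n : ℕ} {f : ι → A.index → Fin n → ℂ} {D E : ℝ≥0}
    (h : A.Bound f D) (hDE : D ≤ E) : A.Bound f E := fun g hg =>
  (h g hg).trans (by gcongr)

/-- Precomposition with `σ` turns bounded coefficient functions for `B` into bounded ones
for `A`. -/
def Pulls (A B : CoordSpace) (σ : A.index → B.index) : Prop :=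
  ∃ C : ℝ≥0, ∀ (ι : Type) (n : ℕ) (f : ι → B.index → Fin n → ℂ) (D : ℝ≥0),
    B.Bound f D → A.Bound (fun p s => f p (σ s)) (C * D)

/-- Complete isomorphism by means of a bijection of the index sets. -/
def Iso (A B : CoordSpace) : Prop :=
  ∃ σ : A.index ≃ B.index, Pulls A B σ ∧ Pulls B A σ.symm

theorem Pulls.comp {A B C : CoordSpace} {σ : A.index → B.index} {τ : B.index → C.index}
    (h : Pulls A B σ) (h' : Pulls B C τ) : Pulls A C (fun s => τ (σ s)) := by
  obtain ⟨c, hc⟩ := h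
  obtain ⟨d, hd⟩ := h'
  refine ⟨c * d, fun ι n f D hf => ?_⟩
  rw [mul_assoc]
  exact hc _ _ _ _ (hd _ _ _ _ hf)

theorem Pulls.of_bound {A B : CoordSpace} {σ : A.index → B.index}
    (h : ∀ (ι : Type) (n : ℕ) (f : ι → B.index → Fin n → ℂ) (D : ℝ≥0),
      B.Bound f D → A.Bound (fun p s => f p (σ s)) D) : Pulls A B σ :=
  ⟨1, by simpa using h⟩

theorem Iso.refl (A : CoordSpace) : Iso A A :=
  ⟨Equiv.refl _, .of_bound fun _ _ _ _ h => h, .of_bound fun _ _ _ _ h => h⟩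

theorem Iso.symm {A B : CoordSpace} : Iso A B → Iso B A
  | ⟨σ, h, h'⟩ => ⟨σ.symm, h', h⟩

theorem Iso.trans {A B C : CoordSpace} : Iso A B → Iso B C → Iso A C
  | ⟨σ, h, h'⟩, ⟨τ, k, k'⟩ => ⟨σ.trans τ, h.comp k, k'.comp h'⟩

/-- The `ℓ^∞` direct sum. -/
def sum (A B : CoordSpace) : CoordSpace where
  index := A.index ⊕ B.index
  Test n := A.Test n ⊕ B.Test n
  weight := Sum.elim A.weight B.weight
  form g f := g.elim (fun g => A.form g fun s => f (.inl s)) (fun g => B.form g fun s => f (.inr s))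

/-- The space of infinite columns. -/
def col (A : CoordSpace) : CoordSpace where
  index := ℕ × A.index
  Test := A.Test
  weight := A.weight
  form g f := ∑' i, A.form g fun s => f (i, s)

theorem bound_sum {A B : CoordSpace} {ι : Type} {n : ℕ} {f : ι → (sum A B).index → Fin n → ℂ}
    {D : ℝ≥0} : (sum A B).Bound f D ↔
      A.Bound (fun p s => f p (.inl s)) D ∧ B.Bound (fun p s => f p (.inr s)) D :=
  ⟨fun h => ⟨fun g => h (.inl g), fun g => h (.inr g)⟩,
    fun h g => by rcases g with g | g; exacts [h.1 g, h.2 g]⟩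

/-- The entries of a column become extra rows of the matrix. This is why rows are indexed by
arbitrary types and not by `Fin n`. -/
theorem bound_col {A : CoordSpace} {ι : Type} {n : ℕ} {f : ι → (col A).index → Fin n → ℂ}
    {D : ℝ≥0} : (col A).Bound f D ↔ A.Bound (fun (p : ι × ℕ) s => f p.1 (p.2, s)) D := by
  refine forall_congr' fun g => ?_
  rw [ENNReal.tsum_prod']
  rfl

theorem Pulls.sum_map {A B A' B' : CoordSpace} {σ : A.index → A'.index} {τ : B.index → B'.index}
    (h : Pulls A A' σ) (k : Pulls B B' τ) :
    Pulls (sum A B) (sum A' B') (Sum.map σ τ) := by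
  obtain ⟨c, hc⟩ := h
  obtain ⟨d, hd⟩ := k
  refine ⟨max c d, fun ι n f D hf => ?_⟩
  rw [bound_sum] at hf ⊢
  exact ⟨(hc _ _ _ _ hf.1).mono (by gcongr; exact le_max_left _ _),
    (hd _ _ _ _ hf.2).mono (by gcongr; exact le_max_right _ _)⟩

theorem Iso.sum_congr {A B A' B' : CoordSpace} : Iso A A' → Iso B B' → Iso (sum A B) (sum A' B')
  | ⟨σ, h, h'⟩, ⟨τ, k, k'⟩ => ⟨Equiv.sumCongr σ τ, h.sum_map k, h'.sum_map k'⟩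

theorem Pulls.col_map {A B : CoordSpace} {σ : A.index → B.index} (h : Pulls A B σ) :
    Pulls (col A) (col B) (Prod.map id σ) := by
  obtain ⟨c, hc⟩ := h
  refine ⟨c, fun ι n f D hf => ?_⟩
  rw [bound_col] at hf ⊢
  exact hc _ _ _ _ hf

theorem Iso.col_congr {A B : CoordSpace} : Iso A B → Iso (col A) (col B)
  | ⟨σ, h, h'⟩ => ⟨Equiv.prodCongr (Equiv.refl ℕ) σ, h.col_map, h'.col_map⟩

theorem Iso.sum_comm (A B : CoordSpace) : Iso (sum A B) (sum B A) :=
  ⟨Equiv.sumComm _ _, .of_bound fun _ _ _ _ h => bound_sum.2 (bound_sum.1 h).symm,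
    .of_bound fun _ _ _ _ h => bound_sum.2 (bound_sum.1 h).symm⟩

theorem Iso.sum_assoc (A B C : CoordSpace) : Iso (sum (sum A B) C) (sum A (sum B C)) := by
  refine ⟨Equiv.sumAssoc _ _ _, .of_bound fun _ _ _ _ h => ?_, .of_bound fun _ _ _ _ h => ?_⟩
  · obtain ⟨h₁, h₂⟩ := bound_sum.1 h
    obtain ⟨h₂, h₃⟩ := bound_sum.1 h₂
    exact bound_sum.2 ⟨bound_sum.2 ⟨h₁, h₂⟩, h₃⟩
  · obtain ⟨h₁, h₂⟩ := bound_sum.1 h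
    obtain ⟨h₁, h₃⟩ := bound_sum.1 h₁
    exact bound_sum.2 ⟨h₁, bound_sum.2 ⟨h₃, h₂⟩⟩

theorem Iso.col_sum (A B : CoordSpace) : Iso (col (sum A B)) (sum (col A) (col B)) := by
  refine ⟨Equiv.prodSumDistrib _ _ _, .of_bound fun _ _ _ _ h => ?_,
    .of_bound fun _ _ _ _ h => ?_⟩
  · obtain ⟨h₁, h₂⟩ := bound_sum.1 h
    exact bound_col.2 (bound_sum.2 ⟨bound_col.1 h₁, bound_col.1 h₂⟩)
  · obtain ⟨h₁, h₂⟩ := bound_sum.1 (bound_col.1 h)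
    exact bound_sum.2 ⟨bound_col.2 h₁, bound_col.2 h₂⟩

/-- Splitting off the first entry of a column. -/
def colEquiv (S : Type) : ℕ × S ≃ S ⊕ ℕ × S where
  toFun x := match x with
    | (0, s) => .inl s
    | (i + 1, s) => .inr (i, s)
  invFun x := match x with
    | .inl s => (0, s)
    | .inr (i, s) => (i + 1, s)
  left_inv := by rintro ⟨_ | i, s⟩ <;> rfl
  right_inv := by rintro (s | ⟨i, s⟩) <;> rfl

/-- The constant 2 compares two norms: squared norms of entries add up in a column, while the direct
sum takes their maximum. -/
theorem Iso.col_succ (A : CoordSpace) : Iso (col A) (sum A (col A)) := by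
  refine ⟨colEquiv _, ⟨2, fun ι n f D h => ?_⟩, .of_bound fun ι n f D h => ?_⟩
  · obtain ⟨h₁, h₂⟩ := bound_sum.1 h
    intro g hg
    calc ∑' p, (col A).form g (fun s => f p (colEquiv _ s))
        = ∑' p, A.form g (fun s => f p (.inl s)) + ∑' p, (col A).form g (fun s => f p (.inr s)) := by
          rw [← ENNReal.tsum_add]
          refine tsum_congr fun p => ?_
          exact tsum_eq_zero_add' ENNReal.summable
      _ ≤ D * A.weight g + D * A.weight g := add_le_add (h₁ g hg) (h₂ g hg)
      _ = (2 * D : ℝ≥0) * A.weight g := by push_cast; ring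
  · refine bound_sum.2 ⟨fun g hg => le_trans (ENNReal.tsum_le_tsum fun p => ?_) (h g hg),
      fun g hg => le_trans (ENNReal.tsum_le_tsum fun p => ?_) (h g hg)⟩
    · exact ENNReal.le_tsum (f := fun i => A.form g fun s => f p (i, s)) 0
    · exact ENNReal.tsum_comp_le_tsum_of_injective (Nat.succ_injective)
        (fun i => A.form g fun s => f p (i, s))

/-- Pełczyński's decomposition method. -/
theorem Iso.of_decomposition {X Y E W Z : CoordSpace} (hX : Iso X (sum E (col X)))
    (hXY : Iso X (sum Y W)) (hYX : Iso Y (sum X Z)) : Iso Y X := by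
  -- If X ≅ A ⊕ B, then col X ≅ col A ⊕ col B, and one more copy of A disappears into col A.
  have absorb {A B : CoordSpace} (h : Iso X (sum A B)) : Iso (sum A (col X)) (col X) := by
    have hc : Iso (col X) (sum (col A) (col B)) := h.col_congr.trans (col_sum _ _)
    refine ((Iso.refl A).sum_congr hc).trans <| (sum_assoc _ _ _).symm.trans ?_
    exact ((col_succ A).symm.sum_congr (.refl _)).trans hc.symm
  -- E is itself a summand of X, so col X absorbs it.
  have hXc : Iso X (col X) := hX.trans (absorb hX)
  have hXX : Iso (sum X X) X :=
    ((Iso.refl X).sum_congr hXc).trans <| (col_succ X).symm.trans hXc.symm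
  have hYXX : Iso (sum Y X) X :=
    ((Iso.refl Y).sum_congr hXc).trans <| (absorb hXY).trans hXc.symm
  refine .trans ?_ hYXX
  refine .trans ?_ (sum_comm X Y)
  -- Y ≅ X ⊕ Z ≅ X ⊕ (X ⊕ Z) ≅ X ⊕ Y, and X ≅ Y ⊕ X is already known.
  refine hYX.trans <| (hXX.symm.sum_congr (.refl Z)).trans <| (sum_assoc _ _ _).trans ?_
  exact (Iso.refl X).sum_congr hYX.symm

end CoordSpace

/-! ### Convolution on words and the Fock coordinate space. -/

section Conv

variable {α β : Type}

theorem finite_factorizations (z : FreeMonoid α) :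
    {p : FreeMonoid α × FreeMonoid α | p.1 * p.2 = z}.Finite := by
  refine ((Finset.range (z.length + 1)).finite_toSet.image
    fun i => (FreeMonoid.ofList (z.toList.take i), FreeMonoid.ofList (z.toList.drop i))).subset ?_
  rintro ⟨x, y⟩ rfl
  refine ⟨x.length, ?_, ?_⟩
  · simp [FreeMonoid.length]
  · simp [FreeMonoid.length]

/-- The pairs of words with product `z`. -/
def factorizations (z : FreeMonoid α) : Finset (FreeMonoid α × FreeMonoid α) :=
  (finite_factorizations z).toFinset

@[simp]
theorem mem_factorizations {z : FreeMonoid α} {p : FreeMonoid α × FreeMonoid α} :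
    p ∈ factorizations z ↔ p.1 * p.2 = z := by
  simp [factorizations]

/-- The convolution of a row with a column of functions on words. -/
def conv {n : ℕ} (f g : FreeMonoid α → Fin n → ℂ) (z : FreeMonoid α) : ℂ :=
  ∑ p ∈ factorizations z, f p.1 ⬝ᵥ g p.2

/-- The square of the `ℓ²` norm of a column of functions on words. -/
def normSq {S : Type} {n : ℕ} (g : S → Fin n → ℂ) : ℝ≥0∞ := ∑' y, ∑ k, ‖g y k‖ₑ ^ 2

/-- The coordinate space of the left multiplication operators on the full Fock space. -/
def fock (α : Type) : CoordSpace where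
  index := FreeMonoid α
  Test n := FreeMonoid α → Fin n → ℂ
  weight := normSq
  form g f := ∑' z, ‖conv f g z‖ₑ ^ 2

/-- The `ι × n` matrix of left multiplication operators with symbols `f` has squared norm at
most `D`. -/
def FockBound {ι : Type} {n : ℕ} (f : ι → FreeMonoid α → Fin n → ℂ) (D : ℝ≥0) : Prop :=
  ∀ g : FreeMonoid α → Fin n → ℂ, normSq g ≠ ⊤ →
    ∑' p, ∑' z, ‖conv (f p) g z‖ₑ ^ 2 ≤ D * normSq g

theorem conv_add {n : ℕ} (f f' g : FreeMonoid α → Fin n → ℂ) (z : FreeMonoid α) :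
    conv (f + f') g z = conv f g z + conv f' g z := by
  simp [conv, add_dotProduct, Finset.sum_add_distrib]

theorem enorm_sum_sq_le {T : Type*} (s : Finset T) (a : T → ℂ) :
    ‖∑ i ∈ s, a i‖ₑ ^ 2 ≤ s.card * ∑ i ∈ s, ‖a i‖ₑ ^ 2 := by
  have h : ‖∑ i ∈ s, a i‖₊ ^ 2 ≤ s.card * ∑ i ∈ s, ‖a i‖₊ ^ 2 := by
    refine (pow_le_pow_left₀ (zero_le) (nnnorm_sum_le s a) 2).trans ?_
    rw [← NNReal.coe_le_coe]
    push_cast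
    exact sq_sum_le_card_mul_sum_sq
  simp only [enorm_eq_nnnorm]
  exact_mod_cast h

theorem enorm_add_sq_le (a b : ℂ) : ‖a + b‖ₑ ^ 2 ≤ 2 * (‖a‖ₑ ^ 2 + ‖b‖ₑ ^ 2) := by
  simpa using enorm_sum_sq_le Finset.univ ![a, b]

theorem FockBound.add {ι : Type} {n : ℕ} {f f' : ι → FreeMonoid α → Fin n → ℂ} {D E : ℝ≥0}
    (h : FockBound f D) (h' : FockBound f' E) :
    FockBound (fun p => f p + f' p) (2 * (D + E)) := by
  intro g hg
  have key (p : ι) : ∑' z, ‖conv (f p + f' p) g z‖ₑ ^ 2 ≤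
      2 * (∑' z, ‖conv (f p) g z‖ₑ ^ 2 + ∑' z, ‖conv (f' p) g z‖ₑ ^ 2) := by
    rw [← ENNReal.tsum_add, ← ENNReal.tsum_mul_left]
    refine ENNReal.tsum_le_tsum fun z => ?_
    rw [conv_add]
    exact enorm_add_sq_le _ _
  refine (ENNReal.tsum_le_tsum key).trans ?_
  rw [ENNReal.tsum_mul_left, ENNReal.tsum_add]
  refine (mul_le_mul_right (add_le_add (h g hg) (h' g hg)) 2).trans_eq ?_
  push_cast
  ring

theorem FockBound.neg {ι : Type} {n : ℕ} {f : ι → FreeMonoid α → Fin n → ℂ} {D : ℝ≥0}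
    (h : FockBound f D) : FockBound (fun p => -f p) D := by
  intro g hg
  refine le_of_eq_of_le (tsum_congr fun p => ?_) (h g hg)
  simp [conv]

theorem FockBound.sub {ι : Type} {n : ℕ} {f f' : ι → FreeMonoid α → Fin n → ℂ} {D E : ℝ≥0}
    (h : FockBound f D) (h' : FockBound f' E) :
    FockBound (fun p => f p - f' p) (2 * (D + E)) := by
  simpa [sub_eq_add_neg] using h.add h'.neg

end Conv

/-! ### Bifix codes and the projections they induce. -/

/-- A bifix code: a family of nonempty words none of which is a prefix or a suffix of another. -/
structure BifixCode {α β : Type} (c : β → FreeMonoid α) : Prop where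
  ne_one : ∀ i, c i ≠ 1
  prefix_free : ∀ i j x y, c i * x = c j * y → i = j
  suffix_free : ∀ i j x y, x * c i = y * c j → i = j

theorem FreeMonoid.eq_of_mul_of_eq {α : Type} {u v : FreeMonoid α} {s t : α}
    (h : u * FreeMonoid.of s = v * FreeMonoid.of t) : s = t :=
  (List.cons.inj (List.append_inj' (h : u.toList ++ [s] = v.toList ++ [t]) rfl).2).1

namespace BifixCode

variable {α β : Type} {c : β → FreeMonoid α}

/-- The words that do not start with a code word. -/
def Remainder (c : β → FreeMonoid α) : Type := {t : FreeMonoid α // ∀ i x, t ≠ c i * x}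

/-- Concatenation of a product of code words and a word that does not start with a code word. -/
def join (c : β → FreeMonoid α) (p : FreeMonoid β × Remainder c) : FreeMonoid α :=
  FreeMonoid.lift c p.1 * p.2.1

/-- Decoding from the left is deterministic: prefix-freeness determines the first code word, and a
remainder begins with none. -/
theorem lift_mul_injective (h : BifixCode c) {u u' : FreeMonoid β} {t t' : Remainder c} :
    FreeMonoid.lift c u * t.1 = FreeMonoid.lift c u' * t'.1 → u = u' ∧ t = t' := by
  induction u using FreeMonoid.inductionOn' generalizing u' with
  | one =>
    induction u' using FreeMonoid.inductionOn' with
    | one => intro e; exact ⟨rfl, Subtype.ext (by simpa using e)⟩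
    | of_mul j v' => intro e; exact absurd (by simpa [mul_assoc] using e) (t.2 j _)
  | of_mul i v ih =>
    induction u' using FreeMonoid.inductionOn' with
    | one => intro e; exact absurd (by simpa [mul_assoc] using e.symm) (t'.2 i _)
    | of_mul j v' =>
      intro e
      simp only [map_mul, FreeMonoid.lift_eval_of, mul_assoc] at e
      obtain rfl := h.prefix_free _ _ _ _ e
      obtain ⟨rfl, rfl⟩ := ih (mul_left_cancel e)
      exact ⟨rfl, rfl⟩

/-- Surjectivity strips code words off the front; they are nonempty, so the length drops. The Fock
space thus splits into copies of the smaller one, one for each remainder. -/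
theorem join_bijective (h : BifixCode c) : Function.Bijective (join c) := by
  refine ⟨fun p q e => Prod.ext_iff.2 (h.lift_mul_injective e), fun z => ?_⟩
  induction hn : z.length using Nat.strong_induction_on generalizing z with
  | _ n ih =>
    by_cases hz : ∀ i x, z ≠ c i * x
    · exact ⟨(1, ⟨z, hz⟩), by simp [join]⟩
    · push Not at hz
      obtain ⟨i, x, rfl⟩ := hz
      have : 0 < (c i).length := Nat.pos_of_ne_zero fun e => h.ne_one i (FreeMonoid.length_eq_zero.1 e)
      rw [FreeMonoid.length_mul] at hn
      obtain ⟨⟨u, t⟩, rfl⟩ := ih x.length (by omega) x rfl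
      exact ⟨(FreeMonoid.of i * u, t), by simp [join, mul_assoc]⟩

theorem lift_injective (h : BifixCode c) : Function.Injective (FreeMonoid.lift c) := by
  intro u u' e
  have h1 : ∀ i x, (1 : FreeMonoid α) ≠ c i * x := fun i x e =>
    h.ne_one i (FreeMonoid.length_eq_zero.1 (by
      have := congrArg FreeMonoid.length e
      rw [FreeMonoid.length_one, FreeMonoid.length_mul] at this
      omega))
  exact (h.lift_mul_injective (t := ⟨1, h1⟩) (t' := ⟨1, h1⟩) (by simpa using e)).1

/-- The submonoid generated by a suffix code is right unitary. -/
theorem exists_of_mul_lift (h : BifixCode c) {x : FreeMonoid α} {y z : FreeMonoid β}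
    (e : x * FreeMonoid.lift c y = FreeMonoid.lift c z) : ∃ x', FreeMonoid.lift c x' = x := by
  induction hn : y.length generalizing y z with
  | zero =>
    obtain rfl := FreeMonoid.length_eq_zero.1 hn
    exact ⟨z, by simpa using e.symm⟩
  | succ n ih =>
    have snoc (w : FreeMonoid β) : w = 1 ∨ ∃ v i, w = v * FreeMonoid.of i := by
      rcases List.eq_nil_or_concat w.toList with hw | ⟨v, i, hw⟩
      · exact .inl hw
      · exact .inr ⟨FreeMonoid.ofList v, i, hw.trans List.concat_eq_append⟩
    obtain rfl | ⟨y, i, rfl⟩ := snoc y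
    · simp at hn
    obtain rfl | ⟨z, j, rfl⟩ := snoc z
    · have := congrArg FreeMonoid.length e
      simp at this
      exact absurd this.2.2 (h.ne_one i)
    · simp only [map_mul, FreeMonoid.lift_eval_of, ← mul_assoc] at e
      obtain rfl := h.suffix_free _ _ _ _ e
      exact ih (mul_right_cancel e) (by simpa using hn)

/-- Only factorizations with right factor in the submonoid contribute; the product being there too,
right unitarity puts the left factor in it as well. -/
theorem conv_extend (h : BifixCode c) {n : ℕ} (f : FreeMonoid α → Fin n → ℂ)
    (g : FreeMonoid β → Fin n → ℂ) (z : FreeMonoid β) :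
    conv f (Function.extend (FreeMonoid.lift c) g 0) (FreeMonoid.lift c z) =
      conv (fun x => f (FreeMonoid.lift c x)) g z := by
  symm
  refine Finset.sum_of_injOn (Prod.map (FreeMonoid.lift c) (FreeMonoid.lift c))
    (h.lift_injective.prodMap h.lift_injective).injOn ?_ ?_ ?_
  · rintro ⟨x, y⟩ hp
    simp only [Finset.mem_coe, mem_factorizations] at hp ⊢
    simp [← hp]
  · rintro ⟨x, y⟩ hp hn
    simp only [mem_factorizations] at hp
    by_cases hy : ∃ y', FreeMonoid.lift c y' = y
    · obtain ⟨y', rfl⟩ := hy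
      obtain ⟨x', rfl⟩ := h.exists_of_mul_lift hp
      refine absurd ⟨(x', y'), ?_, rfl⟩ hn
      rw [← map_mul] at hp
      simpa using h.lift_injective hp
    · simp [Function.extend_apply' _ _ _ hy]
  · rintro ⟨x, y⟩ -
    simp [h.lift_injective.extend_apply]

/-- Multiplying on the left by a product of code words preserves the remainder, so the convolution
acts separately on each copy. -/
theorem extend_conv (h : BifixCode c) {n : ℕ} (f : FreeMonoid β → Fin n → ℂ)
    (g : FreeMonoid α → Fin n → ℂ) (u : FreeMonoid β) (t : Remainder c) :
    conv (Function.extend (FreeMonoid.lift c) f 0) g (join c (u, t)) =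
      conv f (fun v => g (join c (v, t))) u := by
  symm
  refine Finset.sum_of_injOn (fun p => (FreeMonoid.lift c p.1, join c (p.2, t))) ?_ ?_ ?_ ?_
  · rintro ⟨x, y⟩ - ⟨x', y'⟩ - e
    simp only [Prod.mk.injEq] at e
    have := h.join_bijective.1 e.2
    simp only [Prod.mk.injEq] at this
    rw [h.lift_injective e.1, this.1]
  · rintro ⟨x, y⟩ hp
    simp only [Finset.mem_coe, mem_factorizations] at hp ⊢
    simp [← hp, join, mul_assoc]
  · rintro ⟨x, y⟩ hp hn
    simp only [mem_factorizations] at hp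
    by_cases hx : ∃ x', FreeMonoid.lift c x' = x
    · obtain ⟨x', rfl⟩ := hx
      obtain ⟨⟨v, s⟩, rfl⟩ := h.join_bijective.2 y
      have e : join c (x' * v, s) = join c (u, t) := by rw [← hp]; simp [join, mul_assoc]
      have := h.join_bijective.1 e
      simp only [Prod.mk.injEq] at this
      obtain ⟨rfl, rfl⟩ := this
      exact absurd ⟨(x', v), by simp, rfl⟩ hn
    · simp [Function.extend_apply' _ _ _ hx]
  · rintro ⟨x, y⟩ -
    simp [h.lift_injective.extend_apply]

/-- Restricting the symbol compresses the operator to the span of the submonoid, so the bound is not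
enlarged. -/
theorem bound_comp (h : BifixCode c) {ι : Type} {n : ℕ} {f : ι → FreeMonoid α → Fin n → ℂ}
    {D : ℝ≥0} (hf : FockBound f D) :
    FockBound (fun p x => f p (FreeMonoid.lift c x)) D := by
  intro g hg
  have hw : normSq (Function.extend (FreeMonoid.lift c) g 0) = normSq g := by
    rw [normSq, ← h.lift_injective.tsum_eq]
    · simp [normSq, h.lift_injective.extend_apply]
    · intro y hy
      by_contra hy'
      refine hy ?_
      simp only [Function.extend_apply' _ _ _ hy']
      simp
  rw [← hw] at hg ⊢
  refine le_trans (ENNReal.tsum_le_tsum fun p => ?_) (hf _ hg)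
  simp only [← h.conv_extend]
  exact ENNReal.tsum_comp_le_tsum_of_injective h.lift_injective
    (fun z => ‖conv (f p) (Function.extend (FreeMonoid.lift c) g 0) z‖ₑ ^ 2)

theorem tsum_join (h : BifixCode c) (F : FreeMonoid α → ℝ≥0∞) :
    ∑' z, F z = ∑' t, ∑' u, F (join c (u, t)) := by
  rw [← (Equiv.ofBijective _ h.join_bijective).tsum_eq, ENNReal.tsum_prod', ENNReal.tsum_comm]
  rfl

/-- The extended symbol acts as a direct sum of copies of the original operator, one for each
remainder. -/
theorem bound_extend (h : BifixCode c) {ι : Type} {n : ℕ} {f : ι → FreeMonoid β → Fin n → ℂ}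
    {D : ℝ≥0} (hf : FockBound f D) :
    FockBound (fun p => Function.extend (FreeMonoid.lift c) (f p) 0) D := by
  intro g hg
  have hw : normSq g = ∑' t, normSq (fun v => g (join c (v, t))) := h.tsum_join _
  rw [hw] at hg ⊢
  have hp (p : ι) : ∑' z, ‖conv (Function.extend (FreeMonoid.lift c) (f p) 0) g z‖ₑ ^ 2 =
      ∑' t, ∑' u, ‖conv (f p) (fun v => g (join c (v, t))) u‖ₑ ^ 2 := by
    rw [h.tsum_join]
    simp only [h.extend_conv]
  simp only [hp]
  rw [ENNReal.tsum_comm, ← ENNReal.tsum_mul_left]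
  exact ENNReal.tsum_le_tsum fun t => hf _ (ENNReal.ne_top_of_tsum_ne_top hg t)

end BifixCode

/-- The coordinate subspace of the functions that are supported on the range of `j`. -/
def CoordSpace.comap (A : CoordSpace) {S : Type} (j : S → A.index) : CoordSpace where
  index := S
  Test := A.Test
  weight := A.weight
  form g f := A.form g (Function.extend j f 0)

namespace BifixCode

variable {α β : Type} {c : β → FreeMonoid α}

/-- The words over a bifix code span a complemented subspace. -/
theorem iso_sum (h : BifixCode c) {S : Type} {j : S → FreeMonoid α} (hj : Function.Injective j)
    (hS : Set.range j = (Set.range (FreeMonoid.lift c))ᶜ) :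
    CoordSpace.Iso (fock α) (CoordSpace.sum (fock β) ((fock α).comap (S := S) j)) := by
  have hne (u : FreeMonoid β) : ¬ ∃ s, j s = FreeMonoid.lift c u := fun hs =>
    (hS ▸ hs : FreeMonoid.lift c u ∈ (Set.range (FreeMonoid.lift c))ᶜ) ⟨u, rfl⟩
  have hne' (s : S) : ¬ ∃ u, FreeMonoid.lift c u = j s := by
    have : j s ∈ (Set.range (FreeMonoid.lift c))ᶜ := hS ▸ ⟨s, rfl⟩
    exact this
  have hb : Function.Bijective (Sum.elim (FreeMonoid.lift c) j) := by
    refine ⟨h.lift_injective.sumElim hj fun u s e => hne u ⟨s, e.symm⟩, fun z => ?_⟩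
    by_cases hz : z ∈ Set.range (FreeMonoid.lift c)
    · obtain ⟨u, rfl⟩ := hz
      exact ⟨.inl u, rfl⟩
    · rw [← Set.mem_compl_iff, ← hS] at hz
      obtain ⟨s, rfl⟩ := hz
      exact ⟨.inr s, rfl⟩
  let τ : FreeMonoid β ⊕ S ≃ FreeMonoid α := Equiv.ofBijective _ hb
  have split {n : ℕ} (f : FreeMonoid α → Fin n → ℂ) :
      f = Function.extend (FreeMonoid.lift c) (fun u => f (FreeMonoid.lift c u)) 0 +
        Function.extend j (fun s => f (j s)) 0 := by
    funext z
    obtain ⟨u | s, rfl⟩ := hb.2 z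
    · simp [h.lift_injective.extend_apply, Function.extend_apply' _ _ _ (hne u)]
    · simp [hj.extend_apply, Function.extend_apply' _ _ _ (hne' s)]
  -- The complementary part is the identity minus a contraction, of norm at most 2; bounds are on
  -- squares, hence 4.
  have hsub {ι : Type} {n : ℕ} (f : ι → FreeMonoid α → Fin n → ℂ) (D : ℝ≥0) (hf : FockBound f D) :
      FockBound (fun p => Function.extend j (fun s => f p (j s)) 0) (4 * D) := by
    have := hf.sub (h.bound_extend (h.bound_comp hf))
    rw [show 4 * D = 2 * (D + D) by ring]
    have e (p : ι) : f p - Function.extend (FreeMonoid.lift c)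
        (fun u => f p (FreeMonoid.lift c u)) 0 = Function.extend j (fun s => f p (j s)) 0 :=
      sub_eq_of_eq_add' (split (f p))
    simp only [e] at this
    exact this
  have hadd {ι : Type} {n : ℕ} (f : ι → FreeMonoid β ⊕ S → Fin n → ℂ) (D : ℝ≥0)
      (h₁ : FockBound (fun p u => f p (.inl u)) D)
      (h₂ : FockBound (fun p => Function.extend j (fun s => f p (.inr s)) 0) D) :
      FockBound (fun p s => f p (τ.symm s)) (4 * D) := by
    have := (h.bound_extend h₁).add h₂
    rw [show 4 * D = 2 * (D + D) by ring]
    have e₁ (u : FreeMonoid β) : τ.symm (FreeMonoid.lift c u) = .inl u :=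
      τ.symm_apply_eq.2 rfl
    have e₂ (s : S) : τ.symm (j s) = .inr s := τ.symm_apply_eq.2 rfl
    have e (p : ι) := split (fun z => f p (τ.symm z))
    simp only [e₁, e₂] at e
    simpa only [← e] using this
  refine CoordSpace.Iso.symm ⟨τ, ⟨4, fun ι n f D hf => CoordSpace.bound_sum.2 ⟨?_, ?_⟩⟩,
    ⟨4, fun ι n f D hf => ?_⟩⟩
  · exact CoordSpace.Bound.mono (A := fock β) (h.bound_comp hf)
      (le_mul_of_one_le_left zero_le (by norm_num))
  · exact hsub f D hf
  · obtain ⟨h₁, h₂⟩ := CoordSpace.bound_sum.1 hf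
    exact hadd f D h₁ h₂

theorem exists_iso_sum (h : BifixCode c) :
    ∃ W, CoordSpace.Iso (fock α) (CoordSpace.sum (fock β) W) :=
  ⟨_, h.iso_sum (S := ((Set.range (FreeMonoid.lift c))ᶜ : Set _)) Subtype.val_injective
    Subtype.range_val⟩

theorem of_injective {e : β → α} (he : Function.Injective e) :
    BifixCode fun i => FreeMonoid.of (e i) where
  ne_one _ := FreeMonoid.of_ne_one _
  prefix_free _ _ _ _ h := he (List.cons.inj h).1
  suffix_free _ _ _ _ h := he (FreeMonoid.eq_of_mul_of_eq h)

theorem of_isEmpty [IsEmpty β] (c : β → FreeMonoid α) : BifixCode c :=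
  ⟨isEmptyElim, isEmptyElim, isEmptyElim⟩

/-- The infinite bifix code `b a ^ i b`. -/
theorem of_pow {a b : α} (hab : a ≠ b) :
    BifixCode fun i : ℕ => FreeMonoid.of b * FreeMonoid.of a ^ i * FreeMonoid.of b where
  ne_one i h := by simpa using congrArg FreeMonoid.length h
  prefix_free i j x y h := by
    simp only [mul_assoc, mul_right_inj] at h
    induction i generalizing j with
    | zero =>
      cases j with
      | zero => rfl
      | succ j =>
        rw [pow_succ', mul_assoc, pow_zero, one_mul] at h
        exact absurd (List.cons.inj h).1.symm hab
    | succ i ih =>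
      cases j with
      | zero =>
        rw [pow_succ', mul_assoc, pow_zero, one_mul] at h
        exact absurd (List.cons.inj h).1 hab
      | succ j =>
        rw [pow_succ', pow_succ', mul_assoc, mul_assoc, mul_right_inj] at h
        rw [ih j h]
  suffix_free i j x y h := by
    simp only [← mul_assoc, mul_left_inj] at h
    induction i generalizing j with
    | zero =>
      cases j with
      | zero => rfl
      | succ j =>
        rw [pow_succ, ← mul_assoc, pow_zero, mul_one] at h
        exact absurd (FreeMonoid.eq_of_mul_of_eq h).symm hab
    | succ i ih =>
      cases j with
      | zero =>
        rw [pow_succ, ← mul_assoc, pow_zero, mul_one] at h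
        exact absurd (FreeMonoid.eq_of_mul_of_eq h) hab
      | succ j =>
        rw [pow_succ, pow_succ, ← mul_assoc, ← mul_assoc, mul_left_inj] at h
        rw [ih j h]

end BifixCode

/-! ### Splitting off the constant term. -/

theorem conv_extend_of_mul {n : ℕ} (f : ℕ × FreeMonoid ℕ → Fin n → ℂ)
    (g : FreeMonoid ℕ → Fin n → ℂ) (i : ℕ) (z : FreeMonoid ℕ) :
    conv (Function.extend (fun p : ℕ × FreeMonoid ℕ => FreeMonoid.of p.1 * p.2) f 0) g
      (FreeMonoid.of i * z) = conv (fun x => f (i, x)) g z := by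
  have hj : Function.Injective fun p : ℕ × FreeMonoid ℕ => FreeMonoid.of p.1 * p.2 := by
    rintro ⟨i, x⟩ ⟨j, y⟩ h
    exact Prod.ext_iff.2 (List.cons.inj h)
  symm
  refine Finset.sum_of_injOn (fun p => (FreeMonoid.of i * p.1, p.2)) ?_ ?_ ?_ ?_
  · rintro ⟨x, y⟩ - ⟨x', y'⟩ - e
    simpa using e
  · rintro ⟨x, y⟩ hp
    simp only [Finset.mem_coe, mem_factorizations] at hp ⊢
    simp [← hp, mul_assoc]
  · rintro ⟨x, y⟩ hp hn
    simp only [mem_factorizations] at hp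
    -- A nonempty left factor of a word starting with `i` starts with `i` itself, so only the `i`-th
    -- entry of the column is seen.
    by_cases hx : ∃ p : ℕ × FreeMonoid ℕ, FreeMonoid.of p.1 * p.2 = x
    · obtain ⟨⟨j, x⟩, rfl⟩ := hx
      rw [mul_assoc] at hp
      obtain ⟨rfl, hp⟩ := List.cons.inj hp
      exact absurd ⟨(x, y), by simpa using hp, rfl⟩ hn
    · simp [Function.extend_apply' _ _ _ hx]
  · rintro ⟨x, y⟩ -
    simp [hj.extend_apply (a := (i, x))]

/-- Creation operators of distinct letters are isometries with orthogonal ranges, so the squared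
norm of the sum over first letters is that of a column. -/
theorem fock_nat_iso_sum_col :
    CoordSpace.Iso (fock ℕ) (CoordSpace.sum (fock Empty) (fock ℕ).col) := by
  have hj : Function.Injective fun p : ℕ × FreeMonoid ℕ => FreeMonoid.of p.1 * p.2 := by
    rintro ⟨i, x⟩ ⟨j, y⟩ h
    exact Prod.ext_iff.2 (List.cons.inj h)
  have hr : Set.range (fun p : ℕ × FreeMonoid ℕ => FreeMonoid.of p.1 * p.2) = {1}ᶜ := by
    ext z
    induction z using FreeMonoid.inductionOn' with
    | one => simp
    | of_mul i z => simp
  -- The empty code generates only the empty word, so its projection picks out the constant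
  -- coefficient.
  refine ((BifixCode.of_isEmpty (β := Empty) isEmptyElim).iso_sum hj ?_).trans
    (.sum_congr (.refl _) ?_)
  · rw [hr]
    congr 1
    ext z
    constructor
    · rintro rfl
      exact ⟨1, map_one _⟩
    · rintro ⟨u, rfl⟩
      rw [Subsingleton.elim u 1, map_one]
      rfl
  · have key {n : ℕ} (g : FreeMonoid ℕ → Fin n → ℂ) (f : ℕ × FreeMonoid ℕ → Fin n → ℂ) :
        ∑' z, ‖conv (Function.extend
          (fun p : ℕ × FreeMonoid ℕ => FreeMonoid.of p.1 * p.2) f 0) g z‖ₑ ^ 2 =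
        ∑' i, ∑' z, ‖conv (fun x => f (i, x)) g z‖ₑ ^ 2 := by
      rw [← ENNReal.tsum_prod (f := fun i z => ‖conv (fun x => f (i, x)) g z‖ₑ ^ 2)]
      simp only [← conv_extend_of_mul]
      refine (hj.tsum_eq (f := fun z => ‖conv _ g z‖ₑ ^ 2) fun z hz => ?_).symm
      rw [hr]
      rintro rfl
      refine hz ?_
      have : conv (Function.extend
          (fun p : ℕ × FreeMonoid ℕ => FreeMonoid.of p.1 * p.2) f 0) g 1 = 0 := by
        refine Finset.sum_eq_zero fun p hp => ?_
        obtain ⟨x, y⟩ := p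
        have : x = 1 := by
          have := congrArg FreeMonoid.length (mem_factorizations.1 hp)
          simp at this
          exact this.1
        subst this
        rw [Function.extend_apply' _ _ _ (by simp)]
        simp
      simp [this]
    refine ⟨Equiv.refl _, .of_bound fun ι n f D hf g hg => ?_, .of_bound fun ι n f D hf g hg => ?_⟩
    · refine le_of_eq_of_le (tsum_congr fun p => key g (f p)) (hf g hg)
    · refine le_of_eq_of_le (tsum_congr fun p => (key g (f p)).symm) (hf g hg)

theorem fock_fin_iso_fock_nat {k : ℕ} (hk : 2 ≤ k) : CoordSpace.Iso (fock (Fin k)) (fock ℕ) := by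
  obtain ⟨W, hW⟩ := (BifixCode.of_injective (Fin.val_injective (n := k))).exists_iso_sum
  obtain ⟨Z, hZ⟩ := (BifixCode.of_pow (a := (⟨0, by omega⟩ : Fin k)) (b := ⟨1, by omega⟩)
    (by simp)).exists_iso_sum
  exact .of_decomposition fock_nat_iso_sum_col hW hZ

/-! ### Cesàro means. -/

section Cesaro

variable {α : Type}

theorem normSq_mono {S : Type} {n : ℕ} {g g' : S → Fin n → ℂ} (h : ∀ y k, ‖g y k‖ₑ ≤ ‖g' y k‖ₑ) :
    normSq g ≤ normSq g' :=
  ENNReal.tsum_le_tsum fun y => Finset.sum_le_sum fun k _ => by gcongr; exact h y k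

/-- Restriction of a function to the words `y` with `|y| < j ≤ |y| + N`. -/
def window {n : ℕ} (N j : ℕ) (g : FreeMonoid α → Fin n → ℂ) (y : FreeMonoid α) : Fin n → ℂ :=
  if j ∈ Finset.Ioc y.length (y.length + N) then g y else 0

/-- For z = xy the weight `N - x.length` counts the j with |z| < j ≤ |y| + N, that is, the windows
among the N summed at z that contain y. Truncated subtraction gives 0 for long x, as it should. -/
theorem conv_cesaro {n : ℕ} (N : ℕ) (f g : FreeMonoid α → Fin n → ℂ) (z : FreeMonoid α) :
    conv (fun x k => ((N - x.length : ℕ) : ℂ) * f x k) g z =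
      ∑ j ∈ Finset.Ioc z.length (z.length + N), conv f (window N j g) z := by
  simp only [conv]
  rw [Finset.sum_comm]
  refine Finset.sum_congr rfl fun p hp => ?_
  have hl : z.length = p.1.length + p.2.length := by
    rw [← mem_factorizations.1 hp, FreeMonoid.length_mul]
  have hc : ((Finset.Ioc z.length (z.length + N)).filter
      fun j => j ∈ Finset.Ioc p.2.length (p.2.length + N)).card = N - p.1.length := by
    have : (Finset.Ioc z.length (z.length + N)).filter
        (fun j => j ∈ Finset.Ioc p.2.length (p.2.length + N)) =
        Finset.Ioc z.length (p.2.length + N) := by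
      ext j
      simp only [Finset.mem_filter, Finset.mem_Ioc]
      omega
    rw [this, Nat.card_Ioc]
    omega
  have hd (j : ℕ) : f p.1 ⬝ᵥ window N j g p.2 =
      if j ∈ Finset.Ioc p.2.length (p.2.length + N) then f p.1 ⬝ᵥ g p.2 else 0 := by
    unfold window
    split_ifs <;> simp
  simp only [hd]
  rw [← Finset.sum_filter, Finset.sum_const, hc, nsmul_eq_mul]
  simp [dotProduct, Finset.mul_sum, mul_assoc]

theorem tsum_normSq_window {n : ℕ} (N : ℕ) (g : FreeMonoid α → Fin n → ℂ) :
    ∑' j, normSq (window N j g) = N * normSq g := by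
  simp only [normSq]
  rw [ENNReal.tsum_comm, ← ENNReal.tsum_mul_left]
  refine tsum_congr fun y => ?_
  rw [tsum_eq_sum (s := Finset.Ioc y.length (y.length + N))]
  · rw [Finset.sum_congr rfl (g := fun _ => ∑ k, ‖g y k‖ₑ ^ 2)]
    · simp
    · intro j hj
      simp only [window, if_pos hj]
  · intro j hj
    simp only [window, if_neg hj]
    simp

/-- The Cesàro multipliers are contractive. -/
theorem FockBound.cesaro {ι : Type} {n N : ℕ} (hN : N ≠ 0) {f : ι → FreeMonoid α → Fin n → ℂ}
    {D : ℝ≥0} (hf : FockBound f D) :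
    FockBound (fun p x k => (((N - x.length : ℕ) : ℂ) / N) * f p x k) D := by
  intro g hg
  have hle (j : ℕ) : normSq (window N j g) ≤ normSq g := by
    refine normSq_mono fun y k => ?_
    unfold window
    split_ifs <;> simp
  have hN0 : (N : ℝ≥0∞) ≠ 0 := by exact_mod_cast hN
  have hterm (p : ι) (z : FreeMonoid α) :
      (N : ℝ≥0∞) ^ 2 * ‖conv (fun x k => (((N - x.length : ℕ) : ℂ) / N) * f p x k) g z‖ₑ ^ 2 ≤
        N * ∑' j, ‖conv (f p) (window N j g) z‖ₑ ^ 2 := by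
    have e : (N : ℂ) * conv (fun x k => (((N - x.length : ℕ) : ℂ) / N) * f p x k) g z =
        conv (fun x k => ((N - x.length : ℕ) : ℂ) * f p x k) g z := by
      have : (N : ℂ) ≠ 0 := by exact_mod_cast hN
      simp only [conv, dotProduct, Finset.mul_sum]
      refine Finset.sum_congr rfl fun q _ => Finset.sum_congr rfl fun k _ => ?_
      field_simp
    have e' : (N : ℝ≥0∞) = ‖(N : ℂ)‖ₑ := by simp [enorm_eq_nnnorm]
    rw [e', ← mul_pow, ← enorm_mul, e, conv_cesaro, ← e']
    -- Cauchy–Schwarz over N windows costs one factor N; the overlap of the windows in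
    -- `tsum_normSq_window` costs the other, and together they cancel N².
    refine (enorm_sum_sq_le _ _).trans ?_
    rw [Nat.card_Ioc, Nat.add_sub_cancel_left]
    gcongr
    exact ENNReal.sum_le_tsum _
  have hkey : (N : ℝ≥0∞) ^ 2 * ∑' p, ∑' z,
      ‖conv (fun x k => (((N - x.length : ℕ) : ℂ) / N) * f p x k) g z‖ₑ ^ 2 ≤
        N ^ 2 * (D * normSq g) := by
    calc _ ≤ ∑' p, ∑' z, N * ∑' j, ‖conv (f p) (window N j g) z‖ₑ ^ 2 := by
          simp only [← ENNReal.tsum_mul_left]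
          refine ENNReal.tsum_le_tsum fun p => ENNReal.tsum_le_tsum fun z => ?_
          rw [ENNReal.tsum_mul_left]
          exact hterm p z
      _ = N * ∑' j, ∑' p, ∑' z, ‖conv (f p) (window N j g) z‖ₑ ^ 2 := by
          simp only [ENNReal.tsum_mul_left]
          rw [ENNReal.tsum_comm (f := fun j p => ∑' z, ‖conv (f p) (window N j g) z‖ₑ ^ 2)]
          congr 1
          exact tsum_congr fun p => ENNReal.tsum_comm
      _ ≤ N * ∑' j, D * normSq (window N j g) := by
          gcongr with j
          exact hf _ (ne_top_of_le_ne_top hg (hle j))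
      _ = N ^ 2 * (D * normSq g) := by
          rw [ENNReal.tsum_mul_left, tsum_normSq_window]
          ring
  exact (ENNReal.mul_le_mul_iff_right (pow_ne_zero 2 hN0)
    (ENNReal.pow_ne_top (ENNReal.natCast_ne_top N))).1 hkey

end Cesaro

/-! ### Symbols of operators and polynomial approximation. -/

section Symbols

variable {α : Type}

theorem fockSpace_hasSum_norm_sq (v : FockSpace α) : HasSum (fun y => ‖v y‖ ^ 2) (‖v‖ ^ 2) := by
  simpa using lp.hasSum_norm (p := 2) (by norm_num) v

theorem fockSpace_enorm_sq (v : FockSpace α) : ‖v‖ₑ ^ 2 = ∑' y, ‖v y‖ₑ ^ 2 := by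
  have h := fockSpace_hasSum_norm_sq v
  have := ENNReal.ofReal_tsum_of_nonneg (fun y => sq_nonneg ‖v y‖) h.summable
  rw [h.tsum_eq] at this
  simpa [ENNReal.ofReal_pow, ofReal_norm] using this

theorem memℓp_two_of_tsum_ne_top {a : FreeMonoid α → ℂ} (h : ∑' z, ‖a z‖ₑ ^ 2 ≠ ⊤) :
    Memℓp a 2 := by
  refine memℓp_gen ?_
  simpa using ENNReal.summable_toReal h

/-- The convolution of two functions on words. -/
def sconv (f v : FreeMonoid α → ℂ) (z : FreeMonoid α) : ℂ :=
  ∑ p ∈ factorizations z, f p.1 * v p.2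

theorem conv_fin_one (f v : FreeMonoid α → ℂ) (z : FreeMonoid α) :
    conv (fun x (_ : Fin 1) => f x) (fun y _ => v y) z = sconv f v z := by
  simp [conv, sconv, dotProduct]

/-- `f` is the symbol of a left multiplication operator of squared norm at most `D`. -/
def SymbolBound (f : FreeMonoid α → ℂ) (D : ℝ≥0) : Prop :=
  FockBound (fun (_ : Fin 1) x (_ : Fin 1) => f x) D

theorem SymbolBound.tsum_le {f : FreeMonoid α → ℂ} {D : ℝ≥0} (hf : SymbolBound f D)
    (v : FockSpace α) : ∑' z, ‖sconv f v z‖ₑ ^ 2 ≤ D * ‖v‖ₑ ^ 2 := by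
  have := hf (fun y _ => v y)
  simp only [normSq, conv_fin_one, tsum_fintype, Finset.univ_unique, Finset.sum_singleton,
    ← fockSpace_enorm_sq] at this
  exact this (by simp)

/-- The left multiplication operator with symbol `f`. -/
def toeplitz (f : FreeMonoid α → ℂ) {D : ℝ≥0} (hf : SymbolBound f D) :
    FockSpace α →L[ℂ] FockSpace α :=
  LinearMap.mkContinuous
    { toFun := fun v => ⟨sconv f v, memℓp_two_of_tsum_ne_top
        (ne_top_of_le_ne_top (by finiteness) (hf.tsum_le v))⟩
      map_add' := fun v w => by
        ext z
        change sconv f (v + w) z = sconv f v z + sconv f w z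
        simp [sconv, mul_add, Finset.sum_add_distrib]
      map_smul' := fun c v => by
        ext z
        change sconv f (c • v) z = c * sconv f v z
        simp [sconv, Finset.mul_sum, mul_left_comm] }
    (NNReal.sqrt D) fun v => by
      have h := hf.tsum_le v
      set w : FockSpace α := ⟨sconv f v, memℓp_two_of_tsum_ne_top
        (ne_top_of_le_ne_top (by finiteness) (hf.tsum_le v))⟩ with hw
      have h' : ‖w‖ₑ ^ 2 ≤ D * ‖v‖ₑ ^ 2 := (fockSpace_enorm_sq w).trans_le h
      change ‖w‖ ≤ _
      simp only [enorm_eq_nnnorm] at h'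
      norm_cast at h'
      rw [← coe_nnnorm, ← coe_nnnorm, ← NNReal.coe_mul, NNReal.coe_le_coe]
      refine (pow_le_pow_iff_left₀ zero_le zero_le two_ne_zero).1 ?_
      rwa [mul_pow, NNReal.sq_sqrt]

@[simp]
theorem toeplitz_apply {f : FreeMonoid α → ℂ} {D : ℝ≥0} (hf : SymbolBound f D)
    (v : FockSpace α) (z : FreeMonoid α) : toeplitz f hf v z = sconv f v z :=
  rfl

theorem norm_toeplitz_le {f : FreeMonoid α → ℂ} {D : ℝ≥0} (hf : SymbolBound f D) :
    ‖toeplitz f hf‖ ≤ NNReal.sqrt D :=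
  LinearMap.mkContinuous_norm_le _ (by positivity) _

open Classical in
theorem fockBasis_apply (x y : FreeMonoid α) : fockBasis x y = if y = x then (1 : ℂ) else 0 := by
  rw [fockBasis, lp.single_apply, Pi.single_apply]

theorem sconv_fockBasis_mul (f : FreeMonoid α → ℂ) (x y : FreeMonoid α) :
    sconv f (fockBasis y) (x * y) = f x := by
  classical
  rw [sconv, Finset.sum_eq_single (x, y)]
  · simp [fockBasis_apply]
  · rintro ⟨a, b⟩ hp hne
    rw [mem_factorizations] at hp
    rw [fockBasis_apply, if_neg, mul_zero]
    rintro rfl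
    exact hne (Prod.ext (mul_right_cancel hp) rfl)
  · simp

theorem sconv_fockBasis_of_notMem (f : FreeMonoid α → ℂ) {y z : FreeMonoid α}
    (h : z ∉ Set.range fun x => x * y) : sconv f (fockBasis y) z = 0 := by
  classical
  refine Finset.sum_eq_zero fun p hp => ?_
  rw [fockBasis_apply, if_neg, mul_zero]
  rintro rfl
  exact h ⟨p.1, mem_factorizations.1 hp⟩

theorem sconv_fockBasis_one (f : FreeMonoid α → ℂ) : sconv f (fockBasis 1) = f := by
  funext x
  simpa using sconv_fockBasis_mul f x 1

theorem fockSpace_clm_ext {F : Type*} [NormedAddCommGroup F] [NormedSpace ℂ F]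
    {S T : FockSpace α →L[ℂ] F} (h : ∀ y, S (fockBasis y) = T (fockBasis y)) : S = T := by
  classical
  refine lp.ext_continuousLinearMap (by norm_num) fun y => ?_
  ext
  have := h y
  simp only [fockBasis] at this
  simpa [lp.singleContinuousLinearMap_apply] using by convert this

theorem leftMul_apply (w : FreeMonoid α) (v : FockSpace α) (z : FreeMonoid α) :
    leftMul w v z = sconv (fockBasis w) v z := by
  classical
  let Φ : FockSpace α →L[ℂ] ℂ := ∑ p ∈ factorizations z,
    fockBasis w p.1 • lp.evalCLM ℂ (fun _ : FreeMonoid α => ℂ) 2 p.2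
  have h : (lp.evalCLM ℂ (fun _ : FreeMonoid α => ℂ) 2 z) ∘L leftMul w = Φ := by
    refine fockSpace_clm_ext fun y => ?_
    have e : Φ (fockBasis y) = sconv (fockBasis w) (fockBasis y) z := by
      simp [Φ, sconv, lp.evalCLM]
    rw [e]
    change leftMul w (fockBasis y) z = _
    rw [leftMul_fockBasis]
    by_cases hz : z ∈ Set.range fun x => x * y
    · obtain ⟨x, rfl⟩ := hz
      simp [sconv_fockBasis_mul, fockBasis_apply]
    · rw [sconv_fockBasis_of_notMem _ hz, fockBasis_apply, if_neg]
      rintro rfl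
      exact hz ⟨w, rfl⟩
  have := DFunLike.congr_fun h v
  simpa [Φ, sconv, lp.evalCLM] using this

/-- The coefficients of an operator in the analytic Toeplitz algebra. -/
def symbol (T : FockSpace α →L[ℂ] FockSpace α) (x : FreeMonoid α) : ℂ := T (fockBasis 1) x

/-- For fixed v and z the identity is linear in T and involves finitely many coefficients, so it
survives strong limits and need only be checked on `leftMul`. -/
theorem apply_eq_sconv_symbol {T : FockSpace α →L[ℂ] FockSpace α} (hT : T ∈ analyticToeplitz α)
    (v : FockSpace α) (z : FreeMonoid α) : T v z = sconv (symbol T) v z := by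
  let Φ : (FockSpace α →Lₚₜ[ℂ] FockSpace α) →ₗ[ℂ] ℂ :=
    { toFun := fun T => T v z - sconv (fun x => T (fockBasis 1) x) v z
      map_add' := fun S T => by
        simp only [sconv, _root_.add_apply, lp.coeFn_add, Pi.add_apply, add_mul,
          Finset.sum_add_distrib]
        ring
      map_smul' := fun c T => by
        simp only [sconv, _root_.smul_apply, lp.coeFn_smul, Pi.smul_apply,
          smul_eq_mul, mul_assoc, ← Finset.mul_sum, ← mul_sub, RingHom.id_apply] }
  have hev (u : FockSpace α) (x : FreeMonoid α) :
      Continuous fun T : FockSpace α →Lₚₜ[ℂ] FockSpace α => T u x :=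
    (lp.evalCLM ℂ (fun _ : FreeMonoid α => ℂ) 2 x).continuous.comp (continuous_eval_const u)
  have hcont : Continuous Φ :=
    (hev v z).sub (continuous_finsetSum _ fun p _ => (hev _ _).mul continuous_const)
  have hle : ((polynomialOperators α).map (ContinuousLinearMap.toPointwiseConvergenceCLM ℂ
      (RingHom.id ℂ) (FockSpace α) (FockSpace α)).toLinearMap).topologicalClosure ≤
      LinearMap.ker Φ := by
    refine Submodule.topologicalClosure_minimal _ ?_ (isClosed_singleton.preimage hcont)
    rw [polynomialOperators, Submodule.map_span, Submodule.span_le]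
    rintro _ ⟨_, ⟨w, rfl⟩, rfl⟩
    change leftMul w v z - sconv (symbol (leftMul w)) v z = 0
    have : symbol (leftMul w) = fockBasis w := by
      funext x
      rw [symbol, leftMul_fockBasis, mul_one]
    rw [this, leftMul_apply, sub_self]
  exact sub_eq_zero.1 (hle hT)

theorem toeplitz_mem_polynomialOperators {f : FreeMonoid α → ℂ} {D : ℝ≥0} (hf : SymbolBound f D)
    (hfin : f.support.Finite) : toeplitz f hf ∈ polynomialOperators α := by
  classical
  have : toeplitz f hf = ∑ x ∈ hfin.toFinset, f x • leftMul x := by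
    ext v z
    simp only [toeplitz_apply, _root_.sum_apply, lp.coeFn_sum, Finset.sum_apply,
      _root_.smul_apply, lp.coeFn_smul, Pi.smul_apply, smul_eq_mul, leftMul_apply,
      sconv, Finset.mul_sum]
    rw [Finset.sum_comm]
    refine Finset.sum_congr rfl fun p _ => ?_
    simp only [← mul_assoc, ← Finset.sum_mul]
    congr 1
    simp only [fockBasis_apply, mul_ite, mul_one, mul_zero]
    rw [Finset.sum_ite_eq]
    split_ifs with h
    · rfl
    · simpa using h
  rw [this]
  exact Submodule.sum_mem _ fun x _ => Submodule.smul_mem _ _ (Submodule.subset_span ⟨x, rfl⟩)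

theorem mem_sotClosure_of_tendsto {H : Type*} [NormedAddCommGroup H] [InnerProductSpace ℂ H]
    {S : Submodule ℂ (H →L[ℂ] H)} {T : ℕ → H →L[ℂ] H} {T₀ : H →L[ℂ] H} (hT : ∀ N, T N ∈ S)
    (h : ∀ v, Tendsto (fun N => T N v) atTop (𝓝 (T₀ v))) : T₀ ∈ sotClosure S := by
  let toSOT : (H →L[ℂ] H) → (H →Lₚₜ[ℂ] H) :=
    ContinuousLinearMap.toPointwiseConvergenceCLM ℂ (RingHom.id ℂ) H H
  have : Tendsto (fun N => toSOT (T N)) atTop (𝓝 (toSOT T₀)) :=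
    PointwiseConvergenceCLM.tendsto_iff_forall_tendsto.2 h
  change toSOT T₀ ∈ closure _
  exact mem_closure_of_tendsto (X := H →Lₚₜ[ℂ] H) this (.of_forall fun N => ⟨T N, hT N, rfl⟩)

/-- Uniform boundedness gives equicontinuity, so the set of vectors where convergence holds is
closed; it contains the dense span of the basis. -/
theorem tendsto_apply_of_fockBasis {T : ℕ → FockSpace α →L[ℂ] FockSpace α}
    {T₀ : FockSpace α →L[ℂ] FockSpace α} {C : ℝ≥0} (hC : ∀ N, ‖T N‖ ≤ C)
    (h : ∀ y, Tendsto (fun N => T N (fockBasis y)) atTop (𝓝 (T₀ (fockBasis y))))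
    (v : FockSpace α) : Tendsto (fun N => T N v) atTop (𝓝 (T₀ v)) := by
  classical
  have heq : Equicontinuous fun N v => T N v :=
    (LipschitzWith.uniformEquicontinuous (fun N v => T N v) C fun N =>
      (T N).lipschitz.weaken (hC N)).equicontinuous
  have hcl : IsClosed {v | Tendsto (fun N => T N v) atTop (𝓝 (T₀ v))} :=
    heq.isClosed_setOfPred_tendsto T₀.continuous
  refine hcl.mem_of_tendsto (lp.hasSum_single (p := 2) (by norm_num) v) (.of_forall fun s => ?_)
  change Tendsto _ _ _
  simp only [map_sum]
  refine tendsto_finsetSum _ fun y _ => ?_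
  have e : lp.single 2 y (v y) = v y • (fockBasis y : FockSpace α) := by
    ext z
    simp [fockBasis_apply, lp.single_apply, Pi.single_apply]
  simp only [e, map_smul]
  exact (h y).const_smul _

/-- The image of a basis vector is the symbol moved by the injective map x ↦ xy, so strong
convergence reduces to ℓ² convergence of symbols. -/
theorem norm_toeplitz_sub_apply_fockBasis {f f' : FreeMonoid α → ℂ} {D D' : ℝ≥0}
    (hf : SymbolBound f D) (hf' : SymbolBound f' D') (y : FreeMonoid α) :
    ‖toeplitz f hf (fockBasis y) - toeplitz f' hf' (fockBasis y)‖ ^ 2 =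
      ∑' x, ‖f x - f' x‖ ^ 2 := by
  rw [← (fockSpace_hasSum_norm_sq _).tsum_eq, ← (mul_left_injective y).tsum_eq]
  · simp [sconv_fockBasis_mul]
  · intro z hz
    by_contra hn
    exact hz (by simp [sconv_fockBasis_of_notMem _ hn])

/-- Cesàro means of `f`, cut off to the words in the letters of index less than `N`. -/
def approximant (e : α → ℕ) (f : FreeMonoid α → ℂ) (N : ℕ) (x : FreeMonoid α) : ℂ :=
  (((N - x.length : ℕ) : ℂ) / N) *
    Function.extend (FreeMonoid.lift fun a : {a // e a < N} => FreeMonoid.of a.1)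
      (fun u => f (FreeMonoid.lift (fun a : {a // e a < N} => FreeMonoid.of a.1) u)) 0 x

/-- The cutoff to a subalphabet is the contractive projection of a code of single letters, and
Cesàro multipliers are contractive. -/
theorem symbolBound_approximant (e : α → ℕ) {f : FreeMonoid α → ℂ} {D : ℝ≥0}
    (hf : SymbolBound f D) {N : ℕ} (hN : N ≠ 0) : SymbolBound (approximant e f N) D := by
  have hc : BifixCode fun a : {a // e a < N} => FreeMonoid.of a.1 :=
    .of_injective Subtype.val_injective
  have := (hc.bound_extend (hc.bound_comp hf)).cesaro hN
  refine Eq.subst (motive := fun F => FockBound F D) ?_ this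
  funext _ x k
  rw [approximant]
  congr 1
  by_cases hx : ∃ u, FreeMonoid.lift (fun a : {a // e a < N} => FreeMonoid.of a.1) u = x
  · obtain ⟨u, rfl⟩ := hx
    rw [hc.lift_injective.extend_apply, hc.lift_injective.extend_apply]
  · rw [Function.extend_apply' _ _ _ hx, Function.extend_apply' _ _ _ hx]
    rfl

/-- Bounding the length alone would leave infinitely many words when the alphabet is infinite; hence
the cutoff of letters. -/
theorem approximant_support_finite {e : α → ℕ} (he : Function.Injective e)
    (f : FreeMonoid α → ℂ) (N : ℕ) : (approximant e f N).support.Finite := by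
  have : Finite {a // e a < N} := ((Set.finite_lt_nat N).preimage he.injOn)
  refine ((List.finite_length_lt {a // e a < N} N).image
    (FreeMonoid.lift fun a : {a // e a < N} => FreeMonoid.of a.1)).subset fun x hx => ?_
  by_cases h : ∃ u, FreeMonoid.lift (fun a : {a // e a < N} => FreeMonoid.of a.1) u = x
  · obtain ⟨u, rfl⟩ := h
    refine ⟨u, ?_, rfl⟩
    rw [Function.mem_support, approximant] at hx
    have hl (u) : (FreeMonoid.lift (fun a : {a // e a < N} => FreeMonoid.of a.1) u).length =
        u.length := by
      induction u using FreeMonoid.inductionOn' with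
      | one => simp
      | of_mul a u ih => simp [ih]
    by_contra hu
    have hu : N - u.length = 0 := Nat.sub_eq_zero_of_le (not_lt.1 hu)
    refine hx ?_
    rw [hl, hu]
    simp
  · exact absurd (by simp [approximant, Function.extend_apply' _ _ _ h]) hx

theorem approximant_eventually_eq (e : α → ℕ) (f : FreeMonoid α → ℂ) (x : FreeMonoid α) :
    ∀ᶠ N in atTop, approximant e f N x = (((N - x.length : ℕ) : ℂ) / N) * f x := by
  have h : ∀ᶠ N in atTop,
      ∃ u, FreeMonoid.lift (fun a : {a // e a < N} => FreeMonoid.of a.1) u = x := by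
    induction x using FreeMonoid.inductionOn' with
    | one => exact .of_forall fun N => ⟨1, map_one _⟩
    | of_mul a x ih =>
      filter_upwards [ih, eventually_gt_atTop (e a)] with N ⟨u, hu⟩ ha
      exact ⟨FreeMonoid.of ⟨a, ha⟩ * u, by simp [hu]⟩
  filter_upwards [h] with N ⟨u, hu⟩
  have hc : BifixCode fun a : {a // e a < N} => FreeMonoid.of a.1 :=
    .of_injective Subtype.val_injective
  rw [approximant, ← hu, hc.lift_injective.extend_apply]

theorem norm_approximant_sub_le (e : α → ℕ) (f : FreeMonoid α → ℂ) (N : ℕ) (x : FreeMonoid α) :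
    ‖approximant e f N x - f x‖ ≤ 2 * ‖f x‖ := by
  have hc : BifixCode fun a : {a // e a < N} => FreeMonoid.of a.1 :=
    .of_injective Subtype.val_injective
  have h1 : ‖((N - x.length : ℕ) : ℂ) / N‖ ≤ 1 := by
    rw [norm_div, Complex.norm_natCast, Complex.norm_natCast]
    exact div_le_one_of_le₀ (by exact_mod_cast Nat.sub_le _ _) (by positivity)
  have h2 : ‖approximant e f N x‖ ≤ ‖f x‖ := by
    rw [approximant, norm_mul]
    refine (mul_le_of_le_one_left (norm_nonneg _) h1).trans ?_
    by_cases hx : ∃ u, FreeMonoid.lift (fun a : {a // e a < N} => FreeMonoid.of a.1) u = x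
    · obtain ⟨u, rfl⟩ := hx
      rw [hc.lift_injective.extend_apply]
    · rw [Function.extend_apply' _ _ _ hx]
      simp
  linarith [norm_sub_le (approximant e f N x) (f x)]

theorem tendsto_approximant (e : α → ℕ) (f : FreeMonoid α → ℂ) (x : FreeMonoid α) :
    Tendsto (fun N => approximant e f N x) atTop (𝓝 (f x)) := by
  have h : Tendsto (fun N : ℕ => (1 - (x.length : ℂ) / N) * f x) atTop (𝓝 ((1 - 0) * f x)) :=
    ((tendsto_const_nhds (x := (1 : ℂ))).sub
      (tendsto_const_div_atTop_nhds_zero_nat (x.length : ℂ))).mul_const _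
  rw [sub_zero, one_mul] at h
  refine h.congr' ?_
  filter_upwards [approximant_eventually_eq e f x, eventually_ge_atTop x.length,
    eventually_gt_atTop 0] with N hN hle hpos
  have : (N : ℂ) ≠ 0 := by exact_mod_cast hpos.ne'
  rw [hN, Nat.cast_sub hle, sub_div, div_self this]

/-- Every bounded left multiplication operator belongs to the analytic Toeplitz algebra. -/
theorem toeplitz_mem_analyticToeplitz [Countable α] {f : FreeMonoid α → ℂ} {D : ℝ≥0}
    (hf : SymbolBound f D) : toeplitz f hf ∈ analyticToeplitz α := by
  obtain ⟨e, he⟩ := exists_injective_nat α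
  -- The index is shifted by one because the Cesàro weights divide by it.
  have hb (N : ℕ) := symbolBound_approximant e hf N.succ_ne_zero
  refine mem_sotClosure_of_tendsto (T := fun N => toeplitz (approximant e f (N + 1)) (hb N))
    (fun N => toeplitz_mem_polynomialOperators _ (approximant_support_finite he f _)) ?_
  refine tendsto_apply_of_fockBasis (C := NNReal.sqrt D) (fun N => norm_toeplitz_le _) fun y => ?_
  rw [tendsto_iff_norm_sub_tendsto_zero]
  have hs : Summable fun x => ‖f x‖ ^ 2 := by
    have := (fockSpace_hasSum_norm_sq (toeplitz f hf (fockBasis 1))).summable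
    simpa [sconv_fockBasis_one] using this
  have h : Tendsto (fun N => ∑' x, ‖approximant e f (N + 1) x - f x‖ ^ 2) atTop
      (𝓝 (∑' x : FreeMonoid α, (0 : ℝ))) := by
    -- The majorant is 4|f|², summable because f is the image of the vacuum vector.
    refine tendsto_tsum_of_dominated_convergence (hs.mul_left 4) (fun x => ?_)
      (.of_forall fun N x => ?_)
    · have := (((tendsto_approximant e f x).comp (tendsto_add_atTop_nat 1)).sub_const
        (f x)).norm.pow 2
      simpa using this
    · rw [Real.norm_of_nonneg (by positivity)]
      calc _ ≤ (2 * ‖f x‖) ^ 2 := by gcongr; exact norm_approximant_sub_le e f _ x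
        _ = 4 * ‖f x‖ ^ 2 := by ring
  rw [tsum_zero] at h
  have h' := h.sqrt
  simpa only [← norm_toeplitz_sub_apply_fockBasis (hb _) hf y, Real.sqrt_zero,
    Real.sqrt_sq (norm_nonneg _)] using h'

theorem symbol_toeplitz {f : FreeMonoid α → ℂ} {D : ℝ≥0} (hf : SymbolBound f D) :
    symbol (toeplitz f hf) = f := by
  funext x
  rw [symbol, toeplitz_apply, sconv_fockBasis_one]

end Symbols

/-! ### From coordinates back to matrix norms. -/

section MatrixNorm

variable {α : Type}

theorem piLp_enorm_sq {n : ℕ} (v : PiLp 2 fun _ : Fin n => FockSpace α) :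
    ‖v‖ₑ ^ 2 = normSq fun y k => v k y := by
  have h : ‖v‖ₑ ^ 2 = ∑ k, ‖v k‖ₑ ^ 2 := by
    have : ‖v‖₊ ^ 2 = ∑ k, ‖v k‖₊ ^ 2 := by
      rw [PiLp.nnnorm_eq_of_L2, NNReal.sq_sqrt]
    simp only [enorm_eq_nnnorm]
    exact_mod_cast this
  rw [h, normSq, Summable.tsum_finsetSum fun _ _ => ENNReal.summable]
  simp only [fockSpace_enorm_sq]

/-- The matrix of symbols of a matrix over the analytic Toeplitz algebra. -/
def symbols {n : ℕ} (A : Matrix (Fin n) (Fin n) (analyticToeplitz α)) (p : Fin n)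
    (x : FreeMonoid α) (k : Fin n) : ℂ :=
  symbol (A p k : FockSpace α →L[ℂ] FockSpace α) x

theorem enorm_sq_matrixOperator {n : ℕ} (A : Matrix (Fin n) (Fin n) (analyticToeplitz α))
    (v : PiLp 2 fun _ : Fin n => FockSpace α) :
    ‖matrixOperator (A.map fun x => (x : FockSpace α →L[ℂ] FockSpace α)) v‖ₑ ^ 2 =
      ∑' p, ∑' z, ‖conv (symbols A p) (fun y k => v k y) z‖ₑ ^ 2 := by
  refine Eq.trans ?_ (tsum_fintype _).symm
  rw [piLp_enorm_sq, normSq, ← Summable.tsum_finsetSum fun _ _ => ENNReal.summable]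
  refine tsum_congr fun z => Finset.sum_congr rfl fun p _ => ?_
  congr 2
  rw [matrixOperator_apply]
  simp only [Matrix.map_apply, lp.coeFn_sum, Finset.sum_apply,
    apply_eq_sconv_symbol (A p _).2, sconv, conv, dotProduct, symbols]
  rw [Finset.sum_comm]

/-- Test functions of finite weight are exactly the vectors of the n-fold sum of Fock spaces, so
both sides test the same operator; the square root appears since bounds are on squares. -/
theorem fockBound_symbols_iff {n : ℕ} {A : Matrix (Fin n) (Fin n) (analyticToeplitz α)}
    {D : ℝ≥0} : FockBound (symbols A) D ↔ matrixNorm A ≤ NNReal.sqrt D := by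
  constructor
  · intro h
    refine ContinuousLinearMap.opNorm_le_bound _ (by positivity) fun v => ?_
    have h' := h (fun y k => v k y)
    rw [← piLp_enorm_sq, ← enorm_sq_matrixOperator] at h'
    have h' := h' (by finiteness)
    simp only [enorm_eq_nnnorm] at h'
    norm_cast at h'
    rw [← coe_nnnorm, ← coe_nnnorm, ← NNReal.coe_mul, NNReal.coe_le_coe]
    refine (pow_le_pow_iff_left₀ zero_le zero_le two_ne_zero).1 ?_
    rwa [mul_pow, NNReal.sq_sqrt]
  · intro h g hg
    have hm (k : Fin n) : Memℓp (fun y => g y k) 2 := by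
      refine memℓp_two_of_tsum_ne_top (ne_top_of_le_ne_top hg ?_)
      exact ENNReal.tsum_le_tsum fun y =>
        Finset.single_le_sum (f := fun k => ‖g y k‖ₑ ^ 2) (fun _ _ => zero_le) (Finset.mem_univ k)
    let v : PiLp 2 fun _ : Fin n => FockSpace α := WithLp.toLp 2 fun k => ⟨_, hm k⟩
    have hv : (fun y k => v k y) = g := rfl
    rw [← hv, ← enorm_sq_matrixOperator, ← piLp_enorm_sq]
    have := ContinuousLinearMap.le_of_opNorm_le _ h v
    rw [← coe_nnnorm, ← coe_nnnorm, ← NNReal.coe_mul, NNReal.coe_le_coe] at this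
    have := pow_le_pow_left₀ zero_le this 2
    rw [mul_pow, NNReal.sq_sqrt] at this
    simp only [enorm_eq_nnnorm]
    exact_mod_cast this

theorem symbolBound_symbol (T : analyticToeplitz α) : ∃ D, SymbolBound (symbol T.1) D := by
  let A : Matrix (Fin 1) (Fin 1) (analyticToeplitz α) := Matrix.of fun _ _ => T
  refine ⟨‖matrixOperator (A.map fun x => (x : FockSpace α →L[ℂ] FockSpace α))‖₊ ^ 2,
    (fockBound_symbols_iff (A := A)).2 ?_⟩
  rw [NNReal.sqrt_sq]
  rfl

/-- The coefficient map of the analytic Toeplitz algebra. -/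
def symbolMap (α : Type) : analyticToeplitz α →ₗ[ℂ] FreeMonoid α → ℂ where
  toFun T := symbol T.1
  map_add' _ _ := rfl
  map_smul' _ _ := rfl

theorem symbolMap_injective : Function.Injective (symbolMap α) := by
  intro S T h
  ext v z
  rw [apply_eq_sconv_symbol S.2, apply_eq_sconv_symbol T.2]
  exact congrArg (fun f => sconv f v z) h

/-- Membership in the strongly closed algebra becomes a pure boundedness condition on coefficients,
which a coordinate bijection can transport. -/
theorem mem_range_symbolMap [Countable α] {f : FreeMonoid α → ℂ} :
    f ∈ LinearMap.range (symbolMap α) ↔ ∃ D, SymbolBound f D := by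
  constructor
  · rintro ⟨T, rfl⟩
    exact symbolBound_symbol T
  · rintro ⟨D, hf⟩
    exact ⟨⟨toeplitz f hf, toeplitz_mem_analyticToeplitz hf⟩, symbol_toeplitz hf⟩

variable {β : Type}

theorem isCompletelyBounded_of_pulls {u : analyticToeplitz α →ₗ[ℂ] analyticToeplitz β}
    {σ : FreeMonoid β → FreeMonoid α} (hσ : CoordSpace.Pulls (fock β) (fock α) σ)
    (hu : ∀ T x, symbol (u T).1 x = symbol T.1 (σ x)) : IsCompletelyBounded u := by
  obtain ⟨C, hC⟩ := hσ
  refine ⟨NNReal.sqrt C, fun n A => ?_⟩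
  have hA : FockBound (symbols A) (‖matrixOperator (A.map
      fun x => (x : FockSpace α →L[ℂ] FockSpace α))‖₊ ^ 2) := by
    rw [fockBound_symbols_iff, NNReal.sqrt_sq]
    rfl
  have h : FockBound (fun p x => symbols A p (σ x)) _ := hC _ _ _ _ hA
  have e : (fun p x => symbols A p (σ x)) = symbols (A.map u) := by
    funext p x k
    exact (hu _ _).symm
  rw [e, fockBound_symbols_iff, NNReal.sqrt_mul, NNReal.sqrt_sq] at h
  exact h

theorem SymbolBound.comp {σ : FreeMonoid β → FreeMonoid α}
    (hσ : CoordSpace.Pulls (fock β) (fock α) σ) {f : FreeMonoid α → ℂ}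
    (hf : ∃ D, SymbolBound f D) : ∃ D, SymbolBound (fun x => f (σ x)) D := by
  obtain ⟨C, hC⟩ := hσ
  obtain ⟨D, hD⟩ := hf
  exact ⟨C * D, hC (Fin 1) 1 (fun _ x _ => f x) D hD⟩

theorem completelyIsomorphic_of_pulls [Countable α] [Countable β]
    (τ : FreeMonoid α ≃ FreeMonoid β) (h₁ : CoordSpace.Pulls (fock α) (fock β) τ)
    (h₂ : CoordSpace.Pulls (fock β) (fock α) τ.symm) :
    CompletelyIsomorphic (analyticToeplitz α) (analyticToeplitz β) := by
  -- Both ranges consist of the bounded symbols, and boundedness passes along the bijection in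
  -- either direction.
  have hmap : (LinearMap.range (symbolMap α)).map
      (LinearEquiv.funCongrLeft ℂ ℂ τ.symm).toLinearMap = LinearMap.range (symbolMap β) := by
    ext f
    rw [mem_range_symbolMap]
    constructor
    · rintro ⟨f, hf, rfl⟩
      exact SymbolBound.comp h₂ (mem_range_symbolMap.1 hf)
    · intro hf
      refine ⟨fun x => f (τ x), mem_range_symbolMap.2 (SymbolBound.comp h₁ hf), ?_⟩
      funext x
      exact congrArg f (τ.apply_symm_apply x)
  let u : analyticToeplitz α ≃ₗ[ℂ] analyticToeplitz β :=
    (LinearEquiv.ofInjective _ symbolMap_injective).trans <|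
      (LinearEquiv.ofSubmodules (LinearEquiv.funCongrLeft ℂ ℂ τ.symm) _ _ hmap).trans
        (LinearEquiv.ofInjective _ symbolMap_injective).symm
  have hu (T : analyticToeplitz α) (x : FreeMonoid β) :
      symbol (u T).1 x = symbol T.1 (τ.symm x) := by
    have : symbolMap β (u T) = LinearEquiv.funCongrLeft ℂ ℂ τ.symm (symbolMap α T) := by
      have := congrArg Subtype.val (LinearEquiv.apply_symm_apply
        (LinearEquiv.ofInjective (symbolMap β) symbolMap_injective)
        (LinearEquiv.ofSubmodules (LinearEquiv.funCongrLeft ℂ ℂ τ.symm) _ _ hmap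
          (LinearEquiv.ofInjective _ symbolMap_injective T)))
      exact this
    exact congrFun this x
  refine ⟨u, isCompletelyBounded_of_pulls h₂ hu,
    isCompletelyBounded_of_pulls h₁ fun T x => ?_⟩
  have := hu (u.symm T) (τ x)
  rw [u.apply_symm_apply, τ.symm_apply_apply] at this
  exact this.symm

end MatrixNorm

theorem theorem11 (k : ℕ) (hk : 2 ≤ k) :
    CompletelyIsomorphic (analyticToeplitz (Fin k)) (analyticToeplitz ℕ) :=
  have ⟨τ, h₁, h₂⟩ := fock_fin_iso_fock_nat hk
  completelyIsomorphic_of_pulls τ h₁ h₂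

end
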